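/- Let $V$ be a complex vector space of finite dimension $n$, and let $W\subseteq \mathrm{GL}(V)$ be an irreducible complex reflection group: $W$ is finite, it is generated by reflections (elements $t$ whose fixed space $V^t$ has dimension $n-1$), and it cannot be expressed as a direct product $W_1\times W_2$ of reflection groups acting on $V=V_1\oplus V_2$ unless $V_1=0$ or $V_2=0$. If $n=1$, assume that $W$ is not the trivial group. The group $W$ acts on $V$, on $V^*$ by $g\cdot\xi=\xi\circ g^{-1}$, and hence on the exterior algebra $\wedge(V\oplus V^*)$ by algebra automorphisms; this algebra is bigraded with $V$ in bidegree $(1,0)$ and $V^*$ in bidegree $(0,1)$. Let $\theta_1,\dots,\theta_n$ be a basis of $V$, let $\xi_1,\dots,\xi_n$ be the dual basis of $V^*$, and let $$\delta_W=\theta_1\xi_1+\cdots+\theta_n\xi_n\in\wedge(V\oplus V^*)$$ be the Casimir element. Then $\delta_W$ generates the $W$-invariant subring $\wedge(V\oplus V^*)^W$ as a $\mathbb{C}$-algebra. Moreover, for all integers $i,j\ge 0$, the space $\wedge(V\oplus V^*)^W_{i,j}$ of invariants of bidegree $(i,j)$ is one-dimensional if $i=j\le n$ and is zero otherwise, and $\wedge(V\oplus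 V^*)^W_{i,i}$ is spanned by $\delta_W^i$. -/

import Mathlib

noncomputable section

namespace CasimirGeneration

/-- The fixed space `V^t` of a linear automorphism `t` of `V`. -/
def fixedSpace {V : Type*} [AddCommGroup V] [Module ℂ V] (t : V ≃ₗ[ℂ] V) : Submodule ℂ V :=
  LinearMap.eqLocus (t : V →ₗ[ℂ] V) LinearMap.id

/-- `t ∈ GL(V)` is a reflection if `dim V^t = dim V - 1`
(written additively, so that there is no reflection of the zero space). -/
def IsReflection {V : Type*} [AddCommGroup V] [Module ℂ V] (t : V ≃ₗ[ℂ] V) : Prop :=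
  Module.finrank ℂ (fixedSpace t) + 1 = Module.finrank ℂ V

/-- A complex reflection group is a finite subgroup of `GL(V)`, with `V` a finite dimensional
complex vector space, that is generated by the reflections it contains. -/
structure IsComplexReflectionGroup {V : Type*} [AddCommGroup V] [Module ℂ V]
    (W : Subgroup (V ≃ₗ[ℂ] V)) : Prop where
  finiteDimensional : FiniteDimensional ℂ V
  finite : Finite W
  closure_eq : Subgroup.closure {t | t ∈ W ∧ IsReflection t} = W

/-- `W` is the direct product `W₁ × W₂`, acting on `V = V₁ ⊕ V₂` componentwise. -/
def IsDirectProduct {V : Type*} [AddCommGroup V] [Module ℂ V] (W : Subgroup (V ≃ₗ[ℂ] V))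
    {V₁ V₂ : Submodule ℂ V} (W₁ : Subgroup (V₁ ≃ₗ[ℂ] V₁)) (W₂ : Subgroup (V₂ ≃ₗ[ℂ] V₂)) : Prop :=
  IsCompl V₁ V₂ ∧ ∀ g : V ≃ₗ[ℂ] V, g ∈ W ↔
    ∃ g₁ ∈ W₁, ∃ g₂ ∈ W₂, (∀ x : V₁, g x = (g₁ x : V)) ∧ (∀ x : V₂, g x = (g₂ x : V))

/-- An irreducible complex reflection group: one that cannot be expressed as a direct product
`W₁ × W₂` of reflection groups acting on `V = V₁ ⊕ V₂` unless `V₁ = 0` or `V₂ = 0`. -/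
structure IsIrreducibleComplexReflectionGroup {V : Type*} [AddCommGroup V] [Module ℂ V]
    (W : Subgroup (V ≃ₗ[ℂ] V)) : Prop extends IsComplexReflectionGroup W where
  irreducible : ∀ (V₁ V₂ : Submodule ℂ V)
    (W₁ : Subgroup (V₁ ≃ₗ[ℂ] V₁)) (W₂ : Subgroup (V₂ ≃ₗ[ℂ] V₂)),
    IsComplexReflectionGroup W₁ → IsComplexReflectionGroup W₂ →
    IsDirectProduct W W₁ W₂ → V₁ = ⊥ ∨ V₂ = ⊥

/-- The exterior algebra `∧(V ⊕ V*)`. -/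
abbrev ExtDouble (V : Type*) [AddCommGroup V] [Module ℂ V] : Type _ :=
  ExteriorAlgebra ℂ (V × Module.Dual ℂ V)

/-- The embedding of `V` in `∧(V ⊕ V*)`. -/
def ιV (V : Type*) [AddCommGroup V] [Module ℂ V] : V →ₗ[ℂ] ExtDouble V :=
  ExteriorAlgebra.ι ℂ ∘ₗ LinearMap.inl ℂ V (Module.Dual ℂ V)

/-- The embedding of `V*` in `∧(V ⊕ V*)`. -/
def ιDual (V : Type*) [AddCommGroup V] [Module ℂ V] : Module.Dual ℂ V →ₗ[ℂ] ExtDouble V :=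
  ExteriorAlgebra.ι ℂ ∘ₗ LinearMap.inr ℂ V (Module.Dual ℂ V)

/-- The action of `g ∈ GL(V)` on `V ⊕ V*`: `g • (v, ξ) = (g v, ξ ∘ g⁻¹)`. -/
def actSum {V : Type*} [AddCommGroup V] [Module ℂ V] (g : V ≃ₗ[ℂ] V) :
    V × Module.Dual ℂ V →ₗ[ℂ] V × Module.Dual ℂ V :=
  LinearMap.prodMap (g : V →ₗ[ℂ] V) (LinearMap.dualMap (g.symm : V →ₗ[ℂ] V))

/-- The induced action of `g ∈ GL(V)` on `∧(V ⊕ V*)` by algebra homomorphisms. -/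
def act {V : Type*} [AddCommGroup V] [Module ℂ V] (g : V ≃ₗ[ℂ] V) :
    ExtDouble V →ₐ[ℂ] ExtDouble V :=
  ExteriorAlgebra.map (actSum g)

/-- The ring of invariants `∧(V ⊕ V*)^W`. -/
def invariants {V : Type*} [AddCommGroup V] [Module ℂ V] (W : Subgroup (V ≃ₗ[ℂ] V)) :
    Subalgebra ℂ (ExtDouble V) where
  carrier := {x | ∀ g ∈ W, act g x = x}
  mul_mem' hx hy g hg := by rw [map_mul, hx g hg, hy g hg]
  add_mem' hx hy g hg := by rw [map_add, hx g hg, hy g hg]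
  algebraMap_mem' c g _ := AlgHom.commutes (act g) c

/-- The component `∧(V ⊕ V*)_{i,j}` of bidegree `(i,j)`: the span of the products
`v₁ ⋯ vᵢ ξ₁ ⋯ ξⱼ` with `v₁, …, vᵢ ∈ V` and `ξ₁, …, ξⱼ ∈ V*`. -/
def bidegree (V : Type*) [AddCommGroup V] [Module ℂ V] (i j : ℕ) : Submodule ℂ (ExtDouble V) :=
  LinearMap.range (ιV V) ^ i * LinearMap.range (ιDual V) ^ j

/-- The Casimir element `∑ θᵢ ξᵢ`, where `ξ` is the basis of `V*` dual to the basis `θ` of `V`. -/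
def casimir {V : Type*} [AddCommGroup V] [Module ℂ V] {n : ℕ} (θ : Module.Basis (Fin n) ℂ V) :
    ExtDouble V :=
  ∑ i, ιV V (θ i) * ιDual V (θ.dualBasis i)

end CasimirGeneration

end

/-! The finite group `W` is replaced by the Lie algebra 𝔤𝔩(V). Write a reflection as `t v = v + f v
• α`. On ∧(V ⊕ V*) it acts as (1 + E)(1 - sF), where s = (1 + f α)⁻¹, E contracts with f and
multiplies by α, and F contracts with α and multiplies by f. When f α ≠ 0, the fixed vectors of `t`
are killed by E - F, which is the infinitesimal action of v ↦ f(v)α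
(`rankOneAct_eq_zero_of_act_eq`). The endomorphisms of V that kill a given element form a Lie
algebra. For a W-invariant this Lie algebra contains all these rank one maps, and irreducibility
forces it to be 𝔤𝔩(V) (`rankOneAct_eq_zero_of_irreducible`).

It remains to find the 𝔤𝔩(V)-invariants. The identity of V acts on bidegree (i, j) by i - j, so only
i = j survives. Multiplication by δ and contraction with it form an 𝔰𝔩₂-triple with a shifted degree
operator, as in skew Howe duality. If x is invariant of bidegree (k, k), contracting with δ and then
multiplying by δ gives k(n + 1 - k)x (`casimir_mul_lowering`). This scalar is nonzero for 1 ≤ k ≤ n,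
so by induction x is a multiple of δ^k (`mem_span_casimir_pow`). Contraction also shows δ^k ≠ 0 for
k ≤ n. -/

noncomputable section

namespace CasimirGeneration

/-! ### Contractions and the rank one elements of 𝔤𝔩(V) -/

section Operators

variable {V : Type*} [AddCommGroup V] [Module ℂ V]

/-- Contraction of `∧(V ⊕ V*)` with a linear form on `V`. -/
def contractV (h : Module.Dual ℂ V) : ExtDouble V →ₗ[ℂ] ExtDouble V :=
  CliffordAlgebra.contractLeft (h ∘ₗ LinearMap.fst ℂ V (Module.Dual ℂ V))

/-- Contraction of `∧(V ⊕ V*)` with a vector of `V`, seen as a linear form on `V*`. -/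
def contractDual (u : V) : ExtDouble V →ₗ[ℂ] ExtDouble V :=
  CliffordAlgebra.contractLeft (Module.Dual.eval ℂ V u ∘ₗ LinearMap.snd ℂ V (Module.Dual ℂ V))

lemma contractV_ιV_mul (h : Module.Dual ℂ V) (v : V) (x : ExtDouble V) :
    contractV h (ιV V v * x) = h v • x - ιV V v * contractV h x :=
  CliffordAlgebra.contractLeft_ι_mul _ (v, 0) x

lemma contractV_ιDual_mul (h ξ : Module.Dual ℂ V) (x : ExtDouble V) :
    contractV h (ιDual V ξ * x) = - (ιDual V ξ * contractV h x) := by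
  refine (CliffordAlgebra.contractLeft_ι_mul _ (0, ξ) x).trans ?_
  rw [LinearMap.comp_apply, LinearMap.fst_apply, map_zero, zero_smul, zero_sub]
  rfl

lemma contractDual_ιV_mul (u v : V) (x : ExtDouble V) :
    contractDual u (ιV V v * x) = - (ιV V v * contractDual u x) := by
  refine (CliffordAlgebra.contractLeft_ι_mul _ (v, 0) x).trans ?_
  rw [LinearMap.comp_apply, LinearMap.snd_apply, map_zero, zero_smul, zero_sub]
  rfl

lemma contractDual_ιDual_mul (u : V) (ξ : Module.Dual ℂ V) (x : ExtDouble V) :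
    contractDual u (ιDual V ξ * x) = ξ u • x - ιDual V ξ * contractDual u x :=
  CliffordAlgebra.contractLeft_ι_mul _ (0, ξ) x

lemma contractV_algebraMap (h : Module.Dual ℂ V) (r : ℂ) :
    contractV h (algebraMap ℂ (ExtDouble V) r) = 0 :=
  CliffordAlgebra.contractLeft_algebraMap _ _ r

lemma contractDual_algebraMap (u : V) (r : ℂ) :
    contractDual u (algebraMap ℂ (ExtDouble V) r) = 0 :=
  CliffordAlgebra.contractLeft_algebraMap _ _ r

lemma contractV_comm (h k : Module.Dual ℂ V) (x : ExtDouble V) :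
    contractV h (contractV k x) = - contractV k (contractV h x) :=
  CliffordAlgebra.contractLeft_comm _ _ x

lemma contractDual_comm (u v : V) (x : ExtDouble V) :
    contractDual u (contractDual v x) = - contractDual v (contractDual u x) :=
  CliffordAlgebra.contractLeft_comm _ _ x

lemma contractDual_contractV (u : V) (h : Module.Dual ℂ V) (x : ExtDouble V) :
    contractDual u (contractV h x) = - contractV h (contractDual u x) :=
  CliffordAlgebra.contractLeft_comm _ _ x

lemma contractV_self (h : Module.Dual ℂ V) (x : ExtDouble V) :
    contractV h (contractV h x) = 0 :=
  CliffordAlgebra.contractLeft_contractLeft _ x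

lemma contractDual_self (u : V) (x : ExtDouble V) :
    contractDual u (contractDual u x) = 0 :=
  CliffordAlgebra.contractLeft_contractLeft _ x

lemma contractV_add (h k : Module.Dual ℂ V) : contractV (h + k) = contractV h + contractV k := by
  rw [contractV, LinearMap.add_comp, map_add]; rfl

lemma contractV_smul (c : ℂ) (h : Module.Dual ℂ V) : contractV (c • h) = c • contractV h := by
  rw [contractV, LinearMap.smul_comp, map_smul]; rfl

lemma contractDual_add (u v : V) : contractDual (u + v) = contractDual u + contractDual v := by
  rw [contractDual, map_add, LinearMap.add_comp, map_add]; rfl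

lemma contractDual_smul (c : ℂ) (u : V) : contractDual (c • u) = c • contractDual u := by
  rw [contractDual, map_smul, LinearMap.smul_comp, map_smul]; rfl

lemma ι_mul_swap (a b : V × Module.Dual ℂ V) (x : ExtDouble V) :
    ExteriorAlgebra.ι ℂ a * (ExteriorAlgebra.ι ℂ b * x) =
      - (ExteriorAlgebra.ι ℂ b * (ExteriorAlgebra.ι ℂ a * x)) := by
  rw [← mul_assoc, ← mul_assoc, ← neg_mul,
    eq_neg_of_add_eq_zero_left (ExteriorAlgebra.ι_add_mul_swap a b)]

lemma ιV_mul_ιV_mul (u v : V) (x : ExtDouble V) :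
    ιV V u * (ιV V v * x) = - (ιV V v * (ιV V u * x)) := ι_mul_swap _ _ x

lemma ιDual_mul_ιDual_mul (h k : Module.Dual ℂ V) (x : ExtDouble V) :
    ιDual V h * (ιDual V k * x) = - (ιDual V k * (ιDual V h * x)) := ι_mul_swap _ _ x

lemma ιDual_mul_ιV_mul (h : Module.Dual ℂ V) (u : V) (x : ExtDouble V) :
    ιDual V h * (ιV V u * x) = - (ιV V u * (ιDual V h * x)) := ι_mul_swap _ _ x

lemma ιDual_mul_ιV (h : Module.Dual ℂ V) (u : V) :
    ιDual V h * ιV V u = - (ιV V u * ιDual V h) := by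
  simpa using ιDual_mul_ιV_mul h u 1

lemma ιV_mul_self (u : V) (x : ExtDouble V) : ιV V u * (ιV V u * x) = 0 := by
  rw [← mul_assoc]; simp [ιV]

lemma ιDual_mul_self (h : Module.Dual ℂ V) (x : ExtDouble V) :
    ιDual V h * (ιDual V h * x) = 0 := by
  rw [← mul_assoc]; simp [ιDual]

/-- Induction on `∧(V ⊕ V*)` by left multiplication with vectors and covectors. -/
lemma ExtDouble.induction {P : ExtDouble V → Prop}
    (scalar : ∀ r : ℂ, P (algebraMap ℂ _ r)) (add : ∀ x y, P x → P y → P (x + y))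
    (vec : ∀ (v : V) x, P x → P (ιV V v * x))
    (covec : ∀ (ξ : Module.Dual ℂ V) x, P x → P (ιDual V ξ * x)) (x : ExtDouble V) : P x := by
  induction x using CliffordAlgebra.left_induction with
  | algebraMap r => exact scalar r
  | add x y hx hy => exact add x y hx hy
  | ι_mul x m hx =>
    have : CliffordAlgebra.ι 0 m * x = ιV V m.1 * x + ιDual V m.2 * x := by
      rw [← add_mul]
      congr 1
      simp only [ιV, ιDual, LinearMap.comp_apply]
      rw [← map_add]
      simp [ExteriorAlgebra.ι]
    rw [this]
    exact add _ _ (vec _ _ hx) (covec _ _ hx)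

/-- The infinitesimal action on `∧(V ⊕ V*)` of the endomorphism `v ↦ h v • u` of `V`. -/
def rankOneAct (u : V) (h : Module.Dual ℂ V) : ExtDouble V →ₗ[ℂ] ExtDouble V :=
  LinearMap.mulLeft ℂ (ιV V u) ∘ₗ contractV h - LinearMap.mulLeft ℂ (ιDual V h) ∘ₗ contractDual u

lemma rankOneAct_apply (u : V) (h : Module.Dual ℂ V) (x : ExtDouble V) :
    rankOneAct u h x = ιV V u * contractV h x - ιDual V h * contractDual u x := rfl

lemma rankOneAct_add_left (u v : V) (h : Module.Dual ℂ V) (x : ExtDouble V) :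
    rankOneAct (u + v) h x = rankOneAct u h x + rankOneAct v h x := by
  simp only [rankOneAct_apply, map_add, contractDual_add, LinearMap.add_apply, add_mul, mul_add]
  abel

lemma rankOneAct_smul_left (c : ℂ) (u : V) (h : Module.Dual ℂ V) (x : ExtDouble V) :
    rankOneAct (c • u) h x = c • rankOneAct u h x := by
  simp only [rankOneAct_apply, map_smul, contractDual_smul, LinearMap.smul_apply, smul_mul_assoc,
    mul_smul_comm, smul_sub]

lemma rankOneAct_add_right (u : V) (h k : Module.Dual ℂ V) (x : ExtDouble V) :
    rankOneAct u (h + k) x = rankOneAct u h x + rankOneAct u k x := by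
  simp only [rankOneAct_apply, map_add, contractV_add, LinearMap.add_apply, add_mul, mul_add]
  abel

lemma rankOneAct_smul_right (c : ℂ) (u : V) (h : Module.Dual ℂ V) (x : ExtDouble V) :
    rankOneAct u (c • h) x = c • rankOneAct u h x := by
  simp only [rankOneAct_apply, map_smul, contractV_smul, LinearMap.smul_apply, smul_mul_assoc,
    mul_smul_comm, smul_sub]

/-- This is the commutator of rank one endomorphisms in 𝔤𝔩(V). It makes the annihilator of x a Lie
subalgebra. -/
lemma rankOneAct_bracket (u v : V) (h k : Module.Dual ℂ V) (x : ExtDouble V) :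
    rankOneAct u h (rankOneAct v k x) - rankOneAct v k (rankOneAct u h x) =
      h v • rankOneAct u k x - k u • rankOneAct v h x := by
  simp only [rankOneAct_apply, map_sub, contractV_ιV_mul, contractV_ιDual_mul,
    contractDual_ιV_mul, contractDual_ιDual_mul, mul_sub, mul_neg, mul_smul_comm, smul_sub,
    contractDual_contractV, ιDual_mul_ιV_mul]
  rw [contractV_comm k h, contractDual_comm v u, ιV_mul_ιV_mul v u, ιDual_mul_ιDual_mul k h]
  simp only [mul_neg, neg_neg]
  abel

/-- The bracket of the two operators kills x, so the two terms of its expansion agree on x. They are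
eigenvectors of `rankOneAct α f` with opposite eigenvalues f α and -f α, hence both vanish. -/
lemma rankOneAct_eq_zero_of_pair {x : ExtDouble V} {α β : V} {f g : Module.Dual ℂ V}
    (hf : f α ≠ 0) (h₁ : rankOneAct α f x = 0) (h₂ : rankOneAct β g x = 0) :
    f β • rankOneAct α g x = 0 ∧ g α • rankOneAct β f x = 0 := by
  have e₁ := rankOneAct_bracket α β f g x
  rw [h₁, h₂, map_zero, map_zero, sub_zero] at e₁
  have e₂ := rankOneAct_bracket α α f g x
  have e₃ := rankOneAct_bracket α β f f x
  simp only [h₁, map_zero, smul_zero, sub_zero, zero_sub] at e₂ e₃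
  have e₄ : rankOneAct α f (f β • rankOneAct α g x - g α • rankOneAct β f x) = 0 := by
    rw [← e₁, map_zero]
  rw [map_sub, map_smul, map_smul, e₂, e₃, smul_neg, sub_neg_eq_add, smul_comm (f β),
    smul_comm (g α), ← smul_add, smul_eq_zero_iff_right hf] at e₄
  have e₅ := sub_eq_zero.mp e₁.symm
  rw [← e₅, ← two_smul ℂ, smul_eq_zero_iff_right two_ne_zero] at e₄
  exact ⟨e₄, e₅ ▸ e₄⟩

/-- If the rank one operators attached to an irreducible system of roots and coroots annihilate
`x`, then all of `𝔤𝔩(V)` annihilates `x`. -/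
lemma rankOneAct_eq_zero_of_irreducible [FiniteDimensional ℂ V] {x : ExtDouble V}
    (R : Set (V × Module.Dual ℂ V)) (hx : ∀ r ∈ R, rankOneAct r.1 r.2 x = 0)
    (hne : ∀ r ∈ R, r.2 r.1 ≠ 0) (hsymm : ∀ r ∈ R, ∀ s ∈ R, s.2 r.1 = 0 → r.2 s.1 = 0)
    (hirr : ∀ U : Submodule ℂ V, (∀ r ∈ R, ∀ u ∈ U, r.2 u • r.1 ∈ U) → U = ⊥ ∨ U = ⊤)
    (hfix : ∀ v : V, (∀ r ∈ R, r.2 v = 0) → v = 0) (u : V) (h : Module.Dual ℂ V) :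
    rankOneAct u h x = 0 := by
  have key : ∀ r ∈ R, ∀ u, rankOneAct u r.2 x = 0 := by
    intro r hr
    -- The vectors that may be paired with the coroot of r form a subspace containing the root of r.
    -- Once it is stable under R, irreducibility makes it all of V.
    let U : Submodule ℂ V :=
      { carrier := {u | rankOneAct u r.2 x = 0}
        add_mem' := fun {a b} ha hb => by
          simp only [Set.mem_ofPred_eq] at ha hb ⊢
          rw [rankOneAct_add_left, ha, hb, add_zero]
        zero_mem' := by simpa using rankOneAct_smul_left 0 0 r.2 x
        smul_mem' := fun c a ha => by
          simp only [Set.mem_ofPred_eq] at ha ⊢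
          rw [rankOneAct_smul_left, ha, smul_zero] }
    have hU : ∀ s ∈ R, ∀ u ∈ U, s.2 u • s.1 ∈ U := by
      intro s hs u hu
      by_cases h0 : s.2 r.1 = 0
      · have h1 : r.2 s.1 = 0 := hsymm r hr s hs h0
        have e := rankOneAct_bracket s.1 u s.2 r.2 x
        rw [hx s hs, show rankOneAct u r.2 x = 0 from hu, h1] at e
        change rankOneAct _ _ x = 0
        rw [rankOneAct_smul_left]
        simpa using e.symm
      · refine U.smul_mem _ ?_
        have e := (rankOneAct_eq_zero_of_pair (hne r hr) (hx r hr) (hx s hs)).2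
        exact (smul_eq_zero_iff_right h0).mp e
    have hrU : r.1 ∈ U := hx r hr
    rcases hirr U hU with hbot | htop
    · rw [hbot, Submodule.mem_bot] at hrU
      exact absurd (by rw [hrU, map_zero]) (hne r hr)
    · exact fun u => (htop ▸ Submodule.mem_top : u ∈ U)
  -- Dually, the forms h that can be paired with every vector include all coroots, whose common
  -- kernel is zero; so they fill V*.
  let F : Submodule ℂ (Module.Dual ℂ V) :=
    { carrier := {h | ∀ u, rankOneAct u h x = 0}
      add_mem' := fun {a b} ha hb u => by rw [rankOneAct_add_right, ha, hb, add_zero]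
      zero_mem' := fun u => by simpa using rankOneAct_smul_right 0 u 0 x
      smul_mem' := fun c a ha u => by rw [rankOneAct_smul_right, ha, smul_zero] }
  have hF : F.dualCoannihilator = ⊥ := by
    rw [eq_bot_iff]
    intro v hv
    rw [Submodule.mem_dualCoannihilator] at hv
    exact hfix v fun r hr => hv r.2 (key r hr)
  have : F = ⊤ := by
    rw [← Subspace.dualCoannihilator_dualAnnihilator_eq (W := F), hF,
      Submodule.dualAnnihilator_bot]
  exact (this ▸ Submodule.mem_top : h ∈ F) u

end Operators

/-! ### Eigenvectors in stable subspaces and sums of idempotents -/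

lemma mem_of_sum_eigenvectors_mem {K E : Type*} [Field K] [AddCommGroup E] [Module K E]
    {f : Module.End K E} {p : Submodule K E} (hp : ∀ x ∈ p, f x ∈ p) {ι : Type*}
    {μ : ι → K} (hμ : Function.Injective μ) (s : Finset ι) :
    ∀ y : ι → E, (∀ i, f (y i) = μ i • y i) → ∑ i ∈ s, y i ∈ p → ∀ i ∈ s, y i ∈ p := by
  classical
  induction s using Finset.induction_on with
  | empty => simp
  | insert a s ha ih =>
    intro y hy hs
    -- Applying f - μ a removes the a-th term and rescales the others by nonzero factors.
    have h₁ : ∑ i ∈ s, (μ i - μ a) • y i ∈ p := by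
      have := p.sub_mem (hp _ hs) (p.smul_mem (μ a) hs)
      rw [map_sum, Finset.smul_sum, ← Finset.sum_sub_distrib, Finset.sum_insert ha] at this
      simpa [hy, ← sub_smul] using this
    have h₂ : ∀ i ∈ s, y i ∈ p := fun i hi => by
      have hne : μ i - μ a ≠ 0 := sub_ne_zero.mpr (hμ.ne (by rintro rfl; exact ha hi))
      have := ih _ (fun i => by rw [map_smul, hy, smul_comm]) h₁ i hi
      exact (p.smul_mem_iff hne).mp this
    intro i hi
    rcases Finset.mem_insert.mp hi with rfl | hi
    · rw [Finset.sum_insert ha] at hs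
      exact (p.add_mem_iff_left (p.sum_mem h₂)).mp hs
    · exact h₂ i hi

/-- The eigenvalues of a sum of `m` commuting idempotents lie in `{0, …, m}`. -/
lemma eq_zero_of_sum_idempotent_eigenvector {K E ι : Type*} [Field K] [AddCommGroup E] [Module K E]
    {P : ι → Module.End K E} (hid : ∀ i x, P i (P i x) = P i x)
    (hcomm : ∀ i j x, P i (P j x) = P j (P i x)) (s : Finset ι) :
    ∀ (c : K) (x : E), (∀ k : ℕ, k ≤ s.card → c ≠ k) → ∑ i ∈ s, P i x = c • x → x = 0 := by
  classical
  induction s using Finset.induction_on with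
  | empty =>
    intro c x hc hx
    rw [Finset.sum_empty, eq_comm] at hx
    exact (smul_eq_zero_iff_right (by simpa using hc 0 le_rfl)).mp hx
  | insert a s ha ih =>
    intro c x hc hx
    rw [Finset.sum_insert ha] at hx
    rw [Finset.card_insert_of_notMem ha] at hc
    -- `P a x` is an eigenvector of the remaining sum with eigenvalue c - 1, which the induction
    -- hypothesis excludes.
    have h₁ : P a x = 0 := by
      refine ih (c - 1) (P a x) (fun k hk h => hc (k + 1) (by omega) ?_) ?_
      · push_cast; rw [← h]; ring
      · have := congrArg (P a) hx
        rw [map_add, hid, map_sum, map_smul] at this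
        simp_rw [hcomm a] at this
        rw [sub_smul, one_smul, ← this, add_sub_cancel_left]
    rw [h₁, zero_add] at hx
    exact ih c x (fun k hk => hc k (by omega)) hx

/-! ### Number operators and the 𝔰𝔩₂-triple of the Casimir element -/

section Howe

variable {V : Type*} [AddCommGroup V] [Module ℂ V] {n : ℕ} (θ : Module.Basis (Fin n) ℂ V)

/-- The number operator `v₁ ⋯ vᵢ ξ₁ ⋯ ξⱼ ↦ i v₁ ⋯ vᵢ ξ₁ ⋯ ξⱼ`. -/
def numV : Module.End ℂ (ExtDouble V) :=
  ∑ i, LinearMap.mulLeft ℂ (ιV V (θ i)) ∘ₗ contractV (θ.dualBasis i)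

/-- The number operator `v₁ ⋯ vᵢ ξ₁ ⋯ ξⱼ ↦ j v₁ ⋯ vᵢ ξ₁ ⋯ ξⱼ`. -/
def numDual : Module.End ℂ (ExtDouble V) :=
  ∑ i, LinearMap.mulLeft ℂ (ιDual V (θ.dualBasis i)) ∘ₗ contractDual (θ i)

/-- The operator of contraction with the Casimir element. -/
def lowering : Module.End ℂ (ExtDouble V) :=
  ∑ i, contractDual (θ i) ∘ₗ contractV (θ.dualBasis i)

lemma numV_apply (x : ExtDouble V) :
    numV θ x = ∑ i, ιV V (θ i) * contractV (θ.dualBasis i) x := by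
  simp [numV]

lemma numDual_apply (x : ExtDouble V) :
    numDual θ x = ∑ i, ιDual V (θ.dualBasis i) * contractDual (θ i) x := by
  simp [numDual]

lemma lowering_apply (x : ExtDouble V) :
    lowering θ x = ∑ i, contractDual (θ i) (contractV (θ.dualBasis i) x) := by
  simp [lowering]

lemma sum_dualBasis_smul (v : V) : ∑ i, θ.dualBasis i v • θ i = v := by
  simp_rw [Module.Basis.dualBasis_apply]
  exact θ.sum_repr v

lemma sum_smul_dualBasis (h : Module.Dual ℂ V) : ∑ i, h (θ i) • θ.dualBasis i = h := by
  rw [Module.Basis.coe_dualBasis]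
  exact θ.sum_dual_apply_smul_coord h

lemma sum_dualBasis_smul_ιV (v : V) : ∑ i, θ.dualBasis i v • ιV V (θ i) = ιV V v := by
  simp_rw [← map_smul, ← map_sum, sum_dualBasis_smul]

lemma sum_smul_ιDual (h : Module.Dual ℂ V) :
    ∑ i, h (θ i) • ιDual V (θ.dualBasis i) = ιDual V h := by
  simp_rw [← map_smul, ← map_sum, sum_smul_dualBasis]

lemma sum_smul_contractV (h : Module.Dual ℂ V) (x : ExtDouble V) :
    ∑ i, h (θ i) • contractV (θ.dualBasis i) x = contractV h x := by
  conv_rhs => rw [← sum_smul_dualBasis θ h]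
  let c : Module.Dual ℂ V →ₗ[ℂ] ExtDouble V :=
    { toFun := fun h => contractV h x
      map_add' := fun h k => by rw [contractV_add]; rfl
      map_smul' := fun r h => by rw [contractV_smul]; rfl }
  exact ((map_sum c _ _).trans (by simp_rw [map_smul]; rfl)).symm

lemma sum_smul_contractDual (u : V) (x : ExtDouble V) :
    ∑ i, θ.dualBasis i u • contractDual (θ i) x = contractDual u x := by
  conv_rhs => rw [← sum_dualBasis_smul θ u]
  let c : V →ₗ[ℂ] ExtDouble V :=
    { toFun := fun u => contractDual u x
      map_add' := fun h k => by rw [contractDual_add]; rfl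
      map_smul' := fun r h => by rw [contractDual_smul]; rfl }
  exact ((map_sum c _ _).trans (by simp_rw [map_smul]; rfl)).symm

lemma numV_ιV_mul (v : V) (x : ExtDouble V) :
    numV θ (ιV V v * x) = ιV V v * x + ιV V v * numV θ x := by
  simp_rw [numV_apply, contractV_ιV_mul, mul_sub, ιV_mul_ιV_mul _ v, sub_neg_eq_add,
    Finset.sum_add_distrib, mul_smul_comm, ← smul_mul_assoc, ← Finset.sum_mul,
    sum_dualBasis_smul_ιV, Finset.mul_sum]

lemma numV_ιDual_mul (ξ : Module.Dual ℂ V) (x : ExtDouble V) :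
    numV θ (ιDual V ξ * x) = ιDual V ξ * numV θ x := by
  simp_rw [numV_apply, contractV_ιDual_mul, Finset.mul_sum, ιDual_mul_ιV_mul, mul_neg]

lemma numDual_ιV_mul (v : V) (x : ExtDouble V) :
    numDual θ (ιV V v * x) = ιV V v * numDual θ x := by
  simp_rw [numDual_apply, contractDual_ιV_mul, Finset.mul_sum, mul_neg, ιDual_mul_ιV_mul, neg_neg]

lemma numDual_ιDual_mul (ξ : Module.Dual ℂ V) (x : ExtDouble V) :
    numDual θ (ιDual V ξ * x) = ιDual V ξ * x + ιDual V ξ * numDual θ x := by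
  simp_rw [numDual_apply, contractDual_ιDual_mul, mul_sub, ιDual_mul_ιDual_mul _ ξ, sub_neg_eq_add,
    Finset.sum_add_distrib, mul_smul_comm, ← smul_mul_assoc, ← Finset.sum_mul,
    sum_smul_ιDual, Finset.mul_sum]

lemma numV_algebraMap (r : ℂ) : numV θ (algebraMap ℂ _ r) = 0 := by
  simp_rw [numV_apply, contractV_algebraMap, mul_zero, Finset.sum_const_zero]

lemma numDual_algebraMap (r : ℂ) : numDual θ (algebraMap ℂ _ r) = 0 := by
  simp_rw [numDual_apply, contractDual_algebraMap, mul_zero, Finset.sum_const_zero]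

lemma numV_contractV (h : Module.Dual ℂ V) (x : ExtDouble V) :
    numV θ (contractV h x) = contractV h (numV θ x) - contractV h x := by
  simp_rw [numV_apply, map_sum, contractV_ιV_mul, Finset.sum_sub_distrib, sum_smul_contractV,
    contractV_comm h, mul_neg, Finset.sum_neg_distrib]
  abel

lemma numV_contractDual (u : V) (x : ExtDouble V) :
    numV θ (contractDual u x) = contractDual u (numV θ x) := by
  simp_rw [numV_apply, map_sum, contractDual_ιV_mul, contractDual_contractV, mul_neg, neg_neg]

lemma numV_rankOneAct (u : V) (h : Module.Dual ℂ V) (x : ExtDouble V) :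
    numV θ (rankOneAct u h x) = rankOneAct u h (numV θ x) := by
  simp only [rankOneAct_apply, map_sub, numV_ιV_mul, numV_ιDual_mul, numV_contractV,
    numV_contractDual, mul_sub]
  abel

/-- The right side is the action of the identity of V, so an element killed by 𝔤𝔩(V) has equal
degrees in V and V*. -/
lemma numV_sub_numDual (x : ExtDouble V) :
    numV θ x - numDual θ x = ∑ i, rankOneAct (θ i) (θ.dualBasis i) x := by
  simp_rw [numV_apply, numDual_apply, rankOneAct_apply, Finset.sum_sub_distrib]

lemma lowering_contractV (h : Module.Dual ℂ V) (x : ExtDouble V) :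
    lowering θ (contractV h x) = contractV h (lowering θ x) := by
  simp_rw [lowering_apply, map_sum, contractV_comm _ h, map_neg, contractDual_contractV, neg_neg]

lemma lowering_contractDual (u : V) (x : ExtDouble V) :
    lowering θ (contractDual u x) = contractDual u (lowering θ x) := by
  simp_rw [lowering_apply, map_sum]
  refine Finset.sum_congr rfl fun i _ => ?_
  rw [contractDual_comm u, contractDual_contractV u, map_neg, neg_neg]

lemma lowering_ιV_mul (v : V) (x : ExtDouble V) :
    lowering θ (ιV V v * x) = contractDual v x + ιV V v * lowering θ x := by
  simp_rw [lowering_apply, contractV_ιV_mul, map_sub, map_smul, contractDual_ιV_mul,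
    sub_neg_eq_add, Finset.sum_add_distrib, sum_smul_contractDual, Finset.mul_sum]

lemma lowering_ιDual_mul (ξ : Module.Dual ℂ V) (x : ExtDouble V) :
    lowering θ (ιDual V ξ * x) = ιDual V ξ * lowering θ x - contractV ξ x := by
  simp_rw [lowering_apply, contractV_ιDual_mul, map_neg, contractDual_ιDual_mul, neg_sub,
    Finset.sum_sub_distrib, sum_smul_contractV, Finset.mul_sum]

lemma lowering_rankOneAct (u : V) (h : Module.Dual ℂ V) (x : ExtDouble V) :
    lowering θ (rankOneAct u h x) = rankOneAct u h (lowering θ x) := by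
  simp only [rankOneAct_apply, map_sub, lowering_ιV_mul, lowering_ιDual_mul, lowering_contractV,
    lowering_contractDual, contractDual_contractV]
  abel

lemma numV_lowering (x : ExtDouble V) :
    numV θ (lowering θ x) = lowering θ (numV θ x) - lowering θ x := by
  simp_rw [lowering_apply, map_sum, numV_contractDual, numV_contractV, map_sub,
    Finset.sum_sub_distrib]

lemma casimir_mul (x : ExtDouble V) :
    casimir θ * x = ∑ i, ιV V (θ i) * (ιDual V (θ.dualBasis i) * x) := by
  simp_rw [casimir, Finset.sum_mul, mul_assoc]

lemma numV_casimir_mul (x : ExtDouble V) :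
    numV θ (casimir θ * x) = casimir θ * x + casimir θ * numV θ x := by
  simp_rw [casimir_mul, map_sum, numV_ιV_mul, numV_ιDual_mul, Finset.sum_add_distrib]

lemma numDual_casimir_mul (x : ExtDouble V) :
    numDual θ (casimir θ * x) = casimir θ * x + casimir θ * numDual θ x := by
  simp_rw [casimir_mul, map_sum, numDual_ιV_mul, numDual_ιDual_mul, mul_add,
    Finset.sum_add_distrib]

lemma dualBasis_self (i : Fin n) : θ.dualBasis i (θ i) = 1 := by
  simp

/-- The 𝔰𝔩₂ relation: the commutator of contraction and multiplication by δ is n minus the total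
degree. -/
lemma lowering_casimir_mul (x : ExtDouble V) :
    lowering θ (casimir θ * x) =
      casimir θ * lowering θ x + ((n : ℂ) • x - numV θ x - numDual θ x) := by
  simp_rw [casimir_mul, map_sum, lowering_ιV_mul, lowering_ιDual_mul, contractDual_ιDual_mul,
    dualBasis_self, one_smul, mul_sub, Finset.sum_add_distrib, Finset.sum_sub_distrib,
    ← numV_apply, ← numDual_apply, Finset.sum_const, Finset.card_univ, Fintype.card_fin,
    Nat.cast_smul_eq_nsmul]
  abel

/-! ### Invariants of 𝔤𝔩(V) -/

variable (V) in
/-- The elements of `∧(V ⊕ V*)` annihilated by the infinitesimal action of `𝔤𝔩(V)`. -/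
def glInvariants : Submodule ℂ (ExtDouble V) :=
  ⨅ (u : V) (h : Module.Dual ℂ V), LinearMap.ker (rankOneAct u h)

lemma mem_glInvariants {x : ExtDouble V} :
    x ∈ glInvariants V ↔ ∀ u h, rankOneAct u h x = 0 := by
  simp [glInvariants]

variable {θ}

lemma numV_mem_glInvariants {x : ExtDouble V} (hx : x ∈ glInvariants V) :
    numV θ x ∈ glInvariants V := by
  rw [mem_glInvariants] at hx ⊢
  intro u h
  rw [← numV_rankOneAct, hx, map_zero]

lemma lowering_mem_glInvariants {x : ExtDouble V} (hx : x ∈ glInvariants V) :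
    lowering θ x ∈ glInvariants V := by
  rw [mem_glInvariants] at hx ⊢
  intro u h
  rw [← lowering_rankOneAct, hx, map_zero]

lemma numDual_eq_numV {x : ExtDouble V} (hx : x ∈ glInvariants V) : numDual θ x = numV θ x := by
  rw [mem_glInvariants] at hx
  have := numV_sub_numDual θ x
  simp only [hx, Finset.sum_const_zero] at this
  exact (sub_eq_zero.mp this).symm

/-- Invariance lets a covector multiplication followed by a sum over contractions be rewritten
through V alone, which leaves a polynomial in the number operator. In degree k it equals k(n + 1 -
k). -/
lemma casimir_mul_lowering {x : ExtDouble V} (hx : x ∈ glInvariants V) :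
    casimir θ * lowering θ x = ((n : ℂ) + 1) • numV θ x - numV θ (numV θ x) := by
  -- This is the vanishing of the matrix unit v ↦ θᵢ*(v)θⱼ on x.
  have hx' : ∀ i j, ιDual V (θ.dualBasis i) * contractDual (θ j) x =
      ιV V (θ j) * contractV (θ.dualBasis i) x := fun i j =>
    (sub_eq_zero.mp (mem_glInvariants.mp hx (θ j) (θ.dualBasis i))).symm
  -- The summand 1 in n + 1 appears because contraction lowers the degree in V by one.
  have h₁ : ∀ i, ιDual V (θ.dualBasis i) * lowering θ x =
      ((n : ℂ) + 1) • contractV (θ.dualBasis i) x - contractV (θ.dualBasis i) (numV θ x) := by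
    intro i
    have : ∀ j, ιDual V (θ.dualBasis i) * contractDual (θ j) (contractV (θ.dualBasis j) x) =
        contractV (θ.dualBasis i) x -
          ιV V (θ j) * contractV (θ.dualBasis j) (contractV (θ.dualBasis i) x) := by
      intro j
      rw [contractDual_contractV, mul_neg, ← contractV_ιDual_mul, hx', contractV_ιV_mul,
        dualBasis_self, one_smul]
    simp_rw [lowering_apply, Finset.mul_sum, this, Finset.sum_sub_distrib, ← numV_apply,
      numV_contractV, Finset.sum_const, Finset.card_univ, Fintype.card_fin, add_smul, one_smul,
      Nat.cast_smul_eq_nsmul]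
    abel
  simp_rw [casimir_mul, h₁, mul_sub, Finset.sum_sub_distrib, mul_smul_comm, ← Finset.smul_sum,
    ← numV_apply]

/-- The number operator is a sum of n commuting idempotents: contraction with θᵢ* followed by
multiplication by θᵢ keeps the monomials containing θᵢ. -/
lemma eq_zero_of_numV_eq_smul {c : ℂ} (hc : ∀ k : ℕ, k ≤ n → c ≠ k) {x : ExtDouble V}
    (hx : numV θ x = c • x) : x = 0 := by
  refine eq_zero_of_sum_idempotent_eigenvector
    (P := fun i => LinearMap.mulLeft ℂ (ιV V (θ i)) ∘ₗ contractV (θ.dualBasis i)) ?_ ?_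
    Finset.univ c x (by simpa using hc) (by simpa [numV] using hx)
  · intro i x
    simp only [LinearMap.comp_apply, LinearMap.mulLeft_apply, contractV_ιV_mul, contractV_self,
      mul_zero, sub_zero, dualBasis_self, one_smul]
  · intro i j x
    rcases eq_or_ne i j with rfl | hij
    · rfl
    simp only [LinearMap.comp_apply, LinearMap.mulLeft_apply, contractV_ιV_mul,
      Module.Basis.dualBasis_apply_self, if_neg hij, if_neg hij.symm, zero_smul, zero_sub, mul_neg]
    rw [ιV_mul_ιV_mul, contractV_comm (θ.dualBasis i)]
    simp

lemma mem_iSup_eigenspace_numV (x : ExtDouble V) :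
    x ∈ ⨆ k : ℕ, Module.End.eigenspace (numV θ) (k : ℂ) := by
  induction x using ExtDouble.induction with
  | scalar r =>
    refine Submodule.mem_iSup_of_mem 0 ?_
    rw [Module.End.mem_eigenspace_iff, numV_algebraMap, Nat.cast_zero, zero_smul]
  | add x y hx hy => exact add_mem hx hy
  | vec v x hx =>
    refine Submodule.iSup_induction _ (motive := fun x => ιV V v * x ∈ _) hx (fun k y hy => ?_)
      (by rw [mul_zero]; exact zero_mem _) (fun y z hy hz => by rw [mul_add]; exact add_mem hy hz)
    rw [Module.End.mem_eigenspace_iff] at hy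
    refine Submodule.mem_iSup_of_mem (k + 1) ?_
    rw [Module.End.mem_eigenspace_iff, numV_ιV_mul, hy, mul_smul_comm, Nat.cast_succ, add_smul,
      one_smul, add_comm]
  | covec v x hx =>
    refine Submodule.iSup_induction _ (motive := fun x => ιDual V v * x ∈ _) hx (fun k y hy => ?_)
      (by rw [mul_zero]; exact zero_mem _) (fun y z hy hz => by rw [mul_add]; exact add_mem hy hz)
    rw [Module.End.mem_eigenspace_iff] at hy
    refine Submodule.mem_iSup_of_mem k ?_
    rw [Module.End.mem_eigenspace_iff, numV_ιDual_mul, hy, mul_smul_comm]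

/-- The total number operator is diagonalizable with eigenvalue `0` only on the scalars. -/
lemma exists_eq_scalar_add (x : ExtDouble V) : ∃ (r : ℂ),
    ∃ y ∈ ⨆ k : ℕ, Module.End.eigenspace (numV θ + numDual θ) ((k : ℂ) + 1),
      x = algebraMap ℂ _ r + y := by
  induction x using ExtDouble.induction with
  | scalar r => exact ⟨r, 0, zero_mem _, by simp⟩
  | add x y hx hy =>
    obtain ⟨r, x, hx, rfl⟩ := hx
    obtain ⟨s, y, hy, rfl⟩ := hy
    exact ⟨r + s, x + y, add_mem hx hy, by rw [map_add]; abel⟩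
  | vec v x hx =>
    obtain ⟨r, x, hx, rfl⟩ := hx
    refine ⟨0, _, ?_, by rw [map_zero, zero_add]⟩
    rw [mul_add]
    refine add_mem (Submodule.mem_iSup_of_mem 0 ?_) ?_
    · rw [Module.End.mem_eigenspace_iff, LinearMap.add_apply, numV_ιV_mul, numDual_ιV_mul,
        numV_algebraMap, numDual_algebraMap]
      simp
    · refine Submodule.iSup_induction _ (motive := fun x => ιV V v * x ∈ _) hx (fun k y hy => ?_)
        (by rw [mul_zero]; exact zero_mem _) (fun y z hy hz => by rw [mul_add]; exact add_mem hy hz)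
      refine Submodule.mem_iSup_of_mem (k + 1) ?_
      rw [Module.End.mem_eigenspace_iff, LinearMap.add_apply] at hy ⊢
      rw [numV_ιV_mul, numDual_ιV_mul, add_assoc, ← mul_add, hy, mul_smul_comm, Nat.cast_succ]
      module
  | covec v x hx =>
    obtain ⟨r, x, hx, rfl⟩ := hx
    refine ⟨0, _, ?_, by rw [map_zero, zero_add]⟩
    rw [mul_add]
    refine add_mem (Submodule.mem_iSup_of_mem 0 ?_) ?_
    · rw [Module.End.mem_eigenspace_iff, LinearMap.add_apply, numV_ιDual_mul, numDual_ιDual_mul,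
        numV_algebraMap, numDual_algebraMap]
      simp
    · refine Submodule.iSup_induction _ (motive := fun x => ιDual V v * x ∈ _) hx
        (fun k y hy => ?_) (by rw [mul_zero]; exact zero_mem _)
        (fun y z hy hz => by rw [mul_add]; exact add_mem hy hz)
      refine Submodule.mem_iSup_of_mem (k + 1) ?_
      rw [Module.End.mem_eigenspace_iff, LinearMap.add_apply] at hy ⊢
      rw [numV_ιDual_mul, numDual_ιDual_mul, add_left_comm, ← mul_add, hy, mul_smul_comm,
        Nat.cast_succ]
      module

lemma mem_range_algebraMap_of_num_eq_zero {x : ExtDouble V} (h₁ : numV θ x = 0)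
    (h₂ : numDual θ x = 0) : ∃ r : ℂ, x = algebraMap ℂ _ r := by
  obtain ⟨r, y, hy, rfl⟩ := exists_eq_scalar_add (θ := θ) x
  refine ⟨r, ?_⟩
  rw [map_add, numV_algebraMap, zero_add] at h₁
  rw [map_add, numDual_algebraMap, zero_add] at h₂
  have h₀ : y ∈ Module.End.eigenspace (numV θ + numDual θ) (0 : ℂ) := by
    rw [Module.End.mem_eigenspace_iff, LinearMap.add_apply, h₁, h₂, add_zero, zero_smul]
  -- y has total degree 0 and is also a sum of terms of positive degree; eigenspaces are
  -- independent.
  have hdisj := (Module.End.eigenspaces_iSupIndep (numV θ + numDual θ)) 0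
  have : y ∈ ⨆ j, ⨆ (_ : j ≠ (0 : ℂ)), Module.End.eigenspace (numV θ + numDual θ) j := by
    refine (iSup_le fun k : ℕ => ?_ : (⨆ k : ℕ, Module.End.eigenspace (numV θ + numDual θ)
      ((k : ℂ) + 1)) ≤ _) hy
    exact le_iSup₂_of_le ((k : ℂ) + 1) (Nat.cast_add_one_ne_zero k) le_rfl
  rw [Submodule.disjoint_def.mp hdisj y h₀ this, add_zero]

lemma numV_casimir_pow (k : ℕ) : numV θ (casimir θ ^ k) = (k : ℂ) • casimir θ ^ k := by
  induction k with
  | zero => simpa using numV_algebraMap θ 1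
  | succ k ih =>
    rw [pow_succ', numV_casimir_mul, ih, mul_smul_comm, Nat.cast_succ, add_smul, one_smul, add_comm]

lemma numDual_casimir_pow (k : ℕ) : numDual θ (casimir θ ^ k) = (k : ℂ) • casimir θ ^ k := by
  induction k with
  | zero => simpa using numDual_algebraMap θ 1
  | succ k ih =>
    rw [pow_succ', numDual_casimir_mul, ih, mul_smul_comm, Nat.cast_succ, add_smul, one_smul,
      add_comm]

lemma lowering_casimir_pow_succ (k : ℕ) :
    lowering θ (casimir θ ^ (k + 1)) = (((k : ℂ) + 1) * (n - k)) • casimir θ ^ k := by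
  induction k with
  | zero =>
    have h := lowering_casimir_mul θ 1
    have h₁ : lowering θ (1 : ExtDouble V) = 0 := by
      rw [lowering_apply]
      refine Finset.sum_eq_zero fun i _ => ?_
      rw [← map_one (algebraMap ℂ _), contractV_algebraMap, map_zero]
    have h₂ := numV_casimir_pow (θ := θ) 0
    have h₃ := numDual_casimir_pow (θ := θ) 0
    simp only [pow_zero, Nat.cast_zero, zero_smul] at h₂ h₃
    rw [h₁, h₂, h₃] at h
    simpa using h
  | succ k ih =>
    rw [pow_succ', lowering_casimir_mul, ih, numV_casimir_pow, numDual_casimir_pow, mul_smul_comm,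
      ← pow_succ', ← sub_smul, ← sub_smul, ← add_smul]
    congr 1
    push_cast
    ring

/-- Contraction sends δ^(k+1) to (k + 1)(n - k)δ^k, and this factor is nonzero while k < n. -/
lemma casimir_pow_ne_zero {k : ℕ} (hk : k ≤ n) : casimir θ ^ k ≠ 0 := by
  induction k with
  | zero => rw [pow_zero]; exact one_ne_zero
  | succ k ih =>
    intro h
    have e := lowering_casimir_pow_succ (θ := θ) k
    rw [h, map_zero, eq_comm, smul_eq_zero] at e
    refine e.elim (mul_ne_zero (Nat.cast_add_one_ne_zero k) ?_) (ih (by omega))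
    rw [sub_ne_zero]
    exact_mod_cast (by omega : n ≠ k)

lemma casimir_pow_eq_zero {k : ℕ} (hk : n < k) : casimir θ ^ k = 0 :=
  eq_zero_of_numV_eq_smul (fun j hj => by exact_mod_cast (by omega : k ≠ j)) (numV_casimir_pow k)

/-- Contraction with δ gives an invariant of degree one less, known by induction. Multiplying by δ
recovers x up to the scalar of `casimir_mul_lowering`. -/
lemma mem_span_casimir_pow {k : ℕ} : ∀ {x : ExtDouble V}, x ∈ glInvariants V →
    numV θ x = (k : ℂ) • x → x ∈ Submodule.span ℂ {casimir θ ^ k} := by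
  induction k with
  | zero =>
    intro x hx hk
    rw [Nat.cast_zero, zero_smul] at hk
    obtain ⟨r, rfl⟩ := mem_range_algebraMap_of_num_eq_zero hk (by rw [numDual_eq_numV hx, hk])
    rw [Algebra.algebraMap_eq_smul_one, pow_zero]
    exact Submodule.smul_mem _ _ (Submodule.mem_span_singleton_self _)
  | succ k ih =>
    intro x hx hk
    by_cases hkn : k + 1 ≤ n
    swap
    · rw [eq_zero_of_numV_eq_smul (fun j hj => by exact_mod_cast (by omega : k + 1 ≠ j)) hk]
      exact zero_mem _
    have h₁ := casimir_mul_lowering (θ := θ) hx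
    have h₂ := ih (lowering_mem_glInvariants (θ := θ) hx) (by
      rw [numV_lowering, hk, map_smul, Nat.cast_succ, add_smul, one_smul, add_sub_cancel_right])
    rw [Submodule.mem_span_singleton] at h₂
    obtain ⟨c, hc⟩ := h₂
    rw [hk, map_smul, hk, smul_smul, smul_smul, ← sub_smul, ← hc, mul_smul_comm, ← pow_succ'] at h₁
    -- The scalar is (k + 1)(n - k), nonzero because k + 1 ≤ n.
    have hne : ((n : ℂ) + 1) * ((k + 1 : ℕ) : ℂ) - ((k + 1 : ℕ) : ℂ) * ((k + 1 : ℕ) : ℂ) ≠ 0 := by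
      rw [← sub_mul]
      refine mul_ne_zero ?_ (Nat.cast_ne_zero.mpr k.succ_ne_zero)
      rw [sub_ne_zero]
      exact_mod_cast (by omega : n + 1 ≠ k + 1)
    rw [← Submodule.smul_mem_iff _ hne, ← h₁]
    exact Submodule.smul_mem _ _ (Submodule.mem_span_singleton_self _)

lemma glInvariants_le_adjoin :
    glInvariants V ≤ Subalgebra.toSubmodule (Algebra.adjoin ℂ {casimir θ}) := by
  intro x hx
  obtain ⟨m, hm, rfl⟩ := (Submodule.mem_iSup_iff_exists_finsupp _ _).mp
    (mem_iSup_eigenspace_numV (θ := θ) x)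
  have hm' : ∀ k, numV θ (m k) = (k : ℂ) • m k := fun k =>
    Module.End.mem_eigenspace_iff.mp (hm k)
  -- The number operator preserves the invariants, so the homogeneous components of an invariant are
  -- invariant.
  have hG : ∀ k ∈ m.support, m k ∈ glInvariants V :=
    mem_of_sum_eigenvectors_mem (μ := fun k : ℕ => (k : ℂ))
      (fun x hx => numV_mem_glInvariants (θ := θ) hx) Nat.cast_injective m.support m hm' hx
  have hpow : ∀ k, casimir θ ^ k ∈ Algebra.adjoin ℂ {casimir θ} := fun k =>
    pow_mem (Algebra.subset_adjoin (Set.mem_singleton _)) k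
  refine Submodule.sum_mem _ fun k hk => ?_
  obtain ⟨c, hc⟩ := Submodule.mem_span_singleton.mp (mem_span_casimir_pow (hG k hk) (hm' k))
  rw [← hc]
  exact Submodule.smul_mem _ c (hpow k)

lemma num_of_mem_bidegree {i j : ℕ} {x : ExtDouble V} (hx : x ∈ bidegree V i j) :
    numV θ x = (i : ℂ) • x ∧ numDual θ x = (j : ℂ) • x := by
  have hj : LinearMap.range (ιDual V) ^ j ≤
      Module.End.eigenspace (numV θ) (0 : ℂ) ⊓ Module.End.eigenspace (numDual θ) (j : ℂ) := by
    clear hx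
    induction j with
    | zero =>
      rw [pow_zero, Submodule.one_le]
      simp only [Submodule.mem_inf, Module.End.mem_eigenspace_iff]
      have h₁ := numV_algebraMap θ 1
      have h₂ := numDual_algebraMap θ 1
      rw [map_one] at h₁ h₂
      simp [h₁, h₂]
    | succ j ih =>
      rw [pow_succ', Submodule.mul_le]
      rintro _ ⟨ξ, rfl⟩ y hy
      have := ih hy
      simp only [Submodule.mem_inf, Module.End.mem_eigenspace_iff] at this ⊢
      rw [numV_ιDual_mul, numDual_ιDual_mul, this.1, this.2, mul_smul_comm, mul_smul_comm]
      simp [add_smul, add_comm]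
  have hij : bidegree V i j ≤
      Module.End.eigenspace (numV θ) (i : ℂ) ⊓ Module.End.eigenspace (numDual θ) (j : ℂ) := by
    clear hx
    rw [bidegree]
    induction i with
    | zero => simpa using hj
    | succ i ih =>
      rw [pow_succ', mul_assoc, Submodule.mul_le]
      rintro _ ⟨v, rfl⟩ y hy
      have := ih hy
      simp only [Submodule.mem_inf, Module.End.mem_eigenspace_iff] at this ⊢
      rw [numV_ιV_mul, numDual_ιV_mul, this.1, this.2, mul_smul_comm, mul_smul_comm]
      simp [add_smul, add_comm]
  simpa [Module.End.mem_eigenspace_iff] using hij hx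

lemma casimir_pow_mem_bidegree (k : ℕ) : casimir θ ^ k ∈ bidegree V k k := by
  have hle : ∀ {A B : Submodule ℂ (ExtDouble V)}, (∀ a ∈ A, ∀ b ∈ B, a * b = -(b * a)) →
      A * B ≤ B * A := fun {A B} h => Submodule.mul_le.mpr fun a ha b hb => by
    rw [h a ha b hb]
    exact neg_mem (Submodule.mul_mem_mul hb ha)
  -- Vectors anticommute with covectors, and subspaces do not see the sign.
  have hcomm : Commute (LinearMap.range (ιV V)) (LinearMap.range (ιDual V)) := by
    refine le_antisymm (hle ?_) (hle ?_)
    · rintro _ ⟨v, rfl⟩ _ ⟨ξ, rfl⟩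
      rw [ιDual_mul_ιV, neg_neg]
    · rintro _ ⟨v, rfl⟩ _ ⟨ξ, rfl⟩
      exact ιDual_mul_ιV _ _
  rw [bidegree, ← hcomm.mul_pow]
  refine Submodule.pow_mem_pow _ ?_ k
  exact Submodule.sum_mem _ fun i _ => Submodule.mul_mem_mul ⟨_, rfl⟩ ⟨_, rfl⟩

end Howe

/-! ### Reflections and their action on ∧(V ⊕ V*) -/

section Reflection

variable {V : Type*} [AddCommGroup V] [Module ℂ V]

lemma act_ιV (g : V ≃ₗ[ℂ] V) (v : V) : act g (ιV V v) = ιV V (g v) := by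
  simp [act, ιV, actSum]

lemma act_ιDual (g : V ≃ₗ[ℂ] V) (ξ : Module.Dual ℂ V) :
    act g (ιDual V ξ) = ιDual V (ξ ∘ₗ (g.symm : V →ₗ[ℂ] V)) := by
  simp [act, ιDual, actSum, LinearMap.dualMap_apply']

/-- The Casimir element is invariant under all of `GL(V)`. -/
lemma act_casimir {n : ℕ} (θ : Module.Basis (Fin n) ℂ V) (g : V ≃ₗ[ℂ] V) :
    act g (casimir θ) = casimir θ := by
  have h₁ : ∀ i, ιV V (g (θ i)) = ∑ j, θ.dualBasis j (g (θ i)) • ιV V (θ j) := fun i =>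
    (sum_dualBasis_smul_ιV θ _).symm
  have h₂ : ∀ j, ∑ i, θ.dualBasis j (g (θ i)) •
      (θ.dualBasis i ∘ₗ (g.symm : V →ₗ[ℂ] V)) = θ.dualBasis j := by
    intro j
    ext v
    have := LinearMap.congr_fun (sum_smul_dualBasis θ (θ.dualBasis j ∘ₗ (g : V →ₗ[ℂ] V))) (g.symm v)
    simpa [LinearMap.sum_apply] using this
  simp_rw [casimir, map_sum, map_mul, act_ιV, act_ιDual, h₁, Finset.sum_mul, smul_mul_assoc]
  rw [Finset.sum_comm]
  refine Finset.sum_congr rfl fun j _ => ?_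
  simp_rw [← mul_smul_comm, ← Finset.mul_sum, ← map_smul, ← map_sum, h₂]

/-- An automorphism differing from the identity by an endomorphism of rank one acts on
`∧(V ⊕ V*)` through the operators of multiplication and contraction with its root and coroot. -/
lemma act_eq_of_rankOne {t : V ≃ₗ[ℂ] V} {α : V} {f : Module.Dual ℂ V}
    (ht : ∀ v, t v = v + f v • α) (hα : 1 + f α ≠ 0) (x : ExtDouble V) :
    act t x = x - (1 + f α)⁻¹ • (ιDual V f * contractDual α x) + ιV V α * contractV f
      (x - (1 + f α)⁻¹ • (ιDual V f * contractDual α x)) := by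
  set s := (1 + f α)⁻¹ with hs
  have hsymm : ∀ v, t.symm v = v - (s * f v) • α := by
    intro v
    rw [LinearEquiv.symm_apply_eq, map_sub, map_smul, ht, ht]
    have : s * (1 + f α) = 1 := inv_mul_cancel₀ hα
    have h : f v • α = ((s * (1 + f α)) * f v) • α := by rw [this, one_mul]
    rw [h]
    module
  have hdual : ∀ ξ : Module.Dual ℂ V, ξ ∘ₗ (t.symm : V →ₗ[ℂ] V) = ξ - (s * ξ α) • f := by
    intro ξ
    ext v
    simp only [LinearMap.comp_apply, LinearEquiv.coe_coe, hsymm, map_sub, map_smul, smul_eq_mul,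
      LinearMap.sub_apply, LinearMap.smul_apply]
    ring
  induction x using ExtDouble.induction with
  | scalar r =>
    rw [contractDual_algebraMap, mul_zero, smul_zero, sub_zero, contractV_algebraMap, mul_zero,
      add_zero]
    exact AlgHom.commutes _ r
  | add x y hx hy =>
    rw [map_add, hx, hy]
    simp only [map_add, mul_add, smul_add, map_sub, mul_sub]
    abel
  | vec v x hx =>
    rw [map_mul, act_ιV, hx, ht]
    -- The inner factor 1 - sF commutes with multiplication by v; the outer factor 1 + E turns v
    -- into t v.
    have h₁ : ιV V v * x - s • (ιDual V f * contractDual α (ιV V v * x)) =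
        ιV V v * (x - s • (ιDual V f * contractDual α x)) := by
      rw [contractDual_ιV_mul, mul_neg, ιDual_mul_ιV_mul, neg_neg, mul_sub, mul_smul_comm]
    rw [h₁]
    generalize x - s • (ιDual V f * contractDual α x) = y
    rw [contractV_ιV_mul, mul_sub, ιV_mul_ιV_mul α v, map_add, map_smul, mul_add, add_mul, add_mul,
      smul_mul_assoc, smul_mul_assoc, ιV_mul_self, mul_smul_comm]
    simp only [smul_zero, add_zero, sub_neg_eq_add]
    abel
  | covec ξ x hx =>
    rw [map_mul, act_ιDual, hx, hdual]
    -- For covectors the roles are exchanged: 1 - sF turns ξ into ξ ∘ t⁻¹, and 1 + E commutes with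
    -- multiplication by covectors.
    have h₁ : ιDual V ξ * x - s • (ιDual V f * contractDual α (ιDual V ξ * x)) =
        ιDual V (ξ - (s * ξ α) • f) * (x - s • (ιDual V f * contractDual α x)) := by
      rw [contractDual_ιDual_mul, mul_sub, mul_sub, ιDual_mul_ιDual_mul f ξ, map_sub, map_smul,
        sub_mul, sub_mul, mul_smul_comm, mul_smul_comm, mul_smul_comm, smul_mul_assoc,
        smul_mul_assoc, ιDual_mul_self, smul_zero, smul_zero, sub_zero, sub_neg_eq_add, smul_add,
        smul_smul]
      abel
    rw [h₁]
    generalize x - s • (ιDual V f * contractDual α x) = y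
    rw [contractV_ιDual_mul, mul_neg, mul_add, ιDual_mul_ιV_mul]

/-- Invariants of a diagonalizable reflection are annihilated by the rank one operator of its
root and coroot. -/
lemma rankOneAct_eq_zero_of_act_eq {t : V ≃ₗ[ℂ] V} {α : V} {f : Module.Dual ℂ V}
    (ht : ∀ v, t v = v + f v • α) (hα : 1 + f α ≠ 0) (hf : f α ≠ 0) {x : ExtDouble V}
    (hx : act t x = x) : rankOneAct α f x = 0 := by
  rw [act_eq_of_rankOne ht hα] at hx
  let E : ExtDouble V →ₗ[ℂ] ExtDouble V := LinearMap.mulLeft ℂ (ιV V α) ∘ₗ contractV f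
  let F : ExtDouble V →ₗ[ℂ] ExtDouble V := LinearMap.mulLeft ℂ (ιDual V f) ∘ₗ contractDual α
  have hEE : ∀ y, E (E y) = f α • E y := fun y => by
    simp only [E, LinearMap.comp_apply, LinearMap.mulLeft_apply, contractV_ιV_mul, contractV_self,
      mul_zero, sub_zero, mul_smul_comm]
  have hFF : ∀ y, F (F y) = f α • F y := fun y => by
    simp only [F, LinearMap.comp_apply, LinearMap.mulLeft_apply, contractDual_ιDual_mul,
      contractDual_self, mul_zero, sub_zero, mul_smul_comm]
  have hFE : ∀ y, F (E y) = E (F y) := fun y => by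
    simp only [E, F, LinearMap.comp_apply, LinearMap.mulLeft_apply, contractDual_ιV_mul,
      contractV_ιDual_mul, ιDual_mul_ιV_mul, mul_neg, contractDual_contractV, neg_neg]
  set s := (1 + f α)⁻¹ with hs
  have hs1 : s * (1 + f α) = 1 := inv_mul_cancel₀ hα
  have hx' : E x - s • F x - s • E (F x) = 0 := by
    have : x - s • F x + E (x - s • F x) = x := hx
    rw [map_sub, map_smul] at this
    have h := sub_eq_zero.mpr this
    rw [← h]
    abel
  -- With c = f α, E and F commute and satisfy E² = cE, F² = cF. Applying each to the fixed-point
  -- equation gives cEx = EFx = cFx.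
  have h₁ := congrArg E hx'
  have h₂ := congrArg F hx'
  simp only [map_sub, map_smul, map_zero, hEE, hFF, hFE] at h₁ h₂
  have e₁ : f α • E x = E (F x) := by
    have : f α • E x = (s * (1 + f α)) • E (F x) := by
      rw [← sub_eq_zero, ← h₁]; module
    rw [this, hs1, one_smul]
  have e₂ : f α • F x = E (F x) := by
    have hsne : s ≠ 0 := inv_ne_zero hα
    have : s • (f α • F x) = s • E (F x) := by
      have h₃ : (1 - s * f α) • E (F x) = s • (f α • F x) := by
        rw [← sub_eq_zero, ← h₂]; module
      rw [← h₃]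
      congr 1
      linear_combination -hs1
    exact smul_right_injective _ hsne this
  have : f α • (E x - F x) = 0 := by rw [smul_sub, e₁, e₂, sub_self]
  exact (smul_eq_zero_iff_right hf).mp this

/-- A reflection `t` has the form `v ↦ v + f(v) α`. -/
lemma IsReflection.exists_root {t : V ≃ₗ[ℂ] V} [FiniteDimensional ℂ V] (ht : IsReflection t) :
    ∃ (α : V) (f : Module.Dual ℂ V), α ≠ 0 ∧ f ≠ 0 ∧ ∀ v, t v = v + f v • α := by
  let T : V →ₗ[ℂ] V := (t : V →ₗ[ℂ] V) - LinearMap.id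
  have hker : LinearMap.ker T = fixedSpace t := by
    ext v
    simp [T, fixedSpace, sub_eq_zero]
  have hrank : Module.finrank ℂ (LinearMap.range T) = 1 := by
    have := LinearMap.finrank_range_add_finrank_ker T
    rw [hker, ← ht] at this
    omega
  obtain ⟨⟨α, hα⟩, hα0, hspan⟩ := finrank_eq_one_iff'.mp hrank
  have hα0 : α ≠ 0 := fun h => hα0 (Subtype.ext h)
  obtain ⟨φ, hφ⟩ : ∃ φ : Module.Dual ℂ V, φ α ≠ 0 := by
    by_contra! h
    exact hα0 ((Module.forall_dual_apply_eq_zero_iff ℂ α).mp h)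
  have key : ∀ v, t v = v + ((φ α)⁻¹ • (φ ∘ₗ T)) v • α := by
    intro v
    obtain ⟨c, hc⟩ := hspan ⟨T v, LinearMap.mem_range_self T v⟩
    have hc : c • α = T v := congrArg Subtype.val hc
    rw [LinearMap.smul_apply, LinearMap.comp_apply, ← hc, map_smul, smul_eq_mul, smul_eq_mul,
      mul_left_comm, inv_mul_cancel₀ hφ, mul_one, hc]
    simp [T]
  refine ⟨α, _, hα0, ?_, key⟩
  intro h0
  obtain ⟨v, rfl⟩ := hα
  apply hα0
  have := key v
  rw [h0, LinearMap.zero_apply, zero_smul, add_zero] at this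
  simp [T, this]

lemma isReflection_of_root {t : V ≃ₗ[ℂ] V} [FiniteDimensional ℂ V] {α : V} {f : Module.Dual ℂ V}
    (hα : α ≠ 0) (hf : f ≠ 0) (ht : ∀ v, t v = v + f v • α) : IsReflection t := by
  have hker : fixedSpace t = LinearMap.ker f := by
    ext v
    simp [fixedSpace, ht, hα]
  rw [IsReflection, hker, Module.Dual.finrank_ker_add_one_of_ne_zero hf]

/-- A finite linear group preserves a positive definite Hermitian form. -/
lemma exists_invariant_hermitian_form [FiniteDimensional ℂ V] (W : Subgroup (V ≃ₗ[ℂ] V))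
    [Finite W] : ∃ H : V → Module.Dual ℂ V, (∀ g ∈ W, ∀ v w, H (g v) (g w) = H v w) ∧
      (∀ v w, H w v = star (H v w)) ∧ ∀ v, H v v = 0 → v = 0 := by
  classical
  have := Fintype.ofFinite W
  let b := Module.finBasis ℂ V
  -- The standard Hermitian form of a basis, summed over W. It is conjugate-linear in v, so only `H
  -- v` is bundled as a linear form.
  let H : V → Module.Dual ℂ V := fun v =>
    ∑ g : W, ∑ i, star (b.coord i (g.1 v)) • (b.coord i ∘ₗ (g.1 : V →ₗ[ℂ] V))
  have hH : ∀ v w, H v w = ∑ g : W, ∑ i, star (b.coord i (g.1 v)) * b.coord i (g.1 w) := by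
    intro v w
    simp [H, LinearMap.sum_apply]
  refine ⟨H, fun g hg v w => ?_, fun v w => ?_, fun v hv => ?_⟩
  · rw [hH, hH]
    exact Fintype.sum_equiv (Equiv.mulRight (⟨g, hg⟩ : W)) _ _ fun k => rfl
  · rw [hH, hH, star_sum]
    simp_rw [star_sum, star_mul', star_star, mul_comm]
  · rw [hH] at hv
    have hv' : ∑ g : W, ∑ i, Complex.normSq (b.coord i (g.1 v)) = 0 := by
      have : ((∑ g : W, ∑ i, Complex.normSq (b.coord i (g.1 v)) : ℝ) : ℂ) = 0 := by
        push_cast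
        simp_rw [Complex.normSq_eq_conj_mul_self]
        exact hv
      exact_mod_cast this
    rw [Finset.sum_eq_zero_iff_of_nonneg
      (fun g _ => Finset.sum_nonneg fun i _ => Complex.normSq_nonneg _)] at hv'
    -- The term of the identity of W alone already forces all coordinates of v to vanish.
    have h₁ := hv' 1 (Finset.mem_univ _)
    rw [Finset.sum_eq_zero_iff_of_nonneg (fun i _ => Complex.normSq_nonneg _)] at h₁
    refine b.ext_elem fun i => ?_
    have := Complex.normSq_eq_zero.mp (h₁ i (Finset.mem_univ _))
    simpa using this

end Reflection

/-! ### From indecomposability to irreducibility, and to 𝔤𝔩(V)-invariance -/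

section Irreducible

variable {V : Type*} [AddCommGroup V] [Module ℂ V]

/-- The componentwise action of `GL(V₁) × GL(V₂)` on `V = V₁ ⊕ V₂`. -/
def prodAct {V₁ V₂ : Submodule ℂ V} (h : IsCompl V₁ V₂) :
    (V₁ ≃ₗ[ℂ] V₁) × (V₂ ≃ₗ[ℂ] V₂) →* (V ≃ₗ[ℂ] V) where
  toFun p := (V₁.prodEquivOfIsCompl V₂ h).symm ≪≫ₗ
    LinearEquiv.prodCongr p.1 p.2 ≪≫ₗ V₁.prodEquivOfIsCompl V₂ h
  map_one' := by
    ext v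
    exact (V₁.prodEquivOfIsCompl V₂ h).apply_symm_apply v
  map_mul' p q := by
    ext v
    simp

lemma prodAct_apply_left {V₁ V₂ : Submodule ℂ V} (h : IsCompl V₁ V₂)
    (p : (V₁ ≃ₗ[ℂ] V₁) × (V₂ ≃ₗ[ℂ] V₂)) (x : V₁) : prodAct h p x = p.1 x := by
  simp [prodAct]

lemma prodAct_apply_right {V₁ V₂ : Submodule ℂ V} (h : IsCompl V₁ V₂)
    (p : (V₁ ≃ₗ[ℂ] V₁) × (V₂ ≃ₗ[ℂ] V₂)) (x : V₂) : prodAct h p x = p.2 x := by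
  simp [prodAct]

lemma eq_prodAct_iff {V₁ V₂ : Submodule ℂ V} (h : IsCompl V₁ V₂) (g : V ≃ₗ[ℂ] V)
    (p : (V₁ ≃ₗ[ℂ] V₁) × (V₂ ≃ₗ[ℂ] V₂)) :
    g = prodAct h p ↔ (∀ x : V₁, g x = (p.1 x : V)) ∧ (∀ x : V₂, g x = (p.2 x : V)) := by
  refine ⟨?_, fun ⟨h₁, h₂⟩ => ?_⟩
  · rintro rfl
    exact ⟨prodAct_apply_left h p, prodAct_apply_right h p⟩
  · ext v
    obtain ⟨⟨x, y⟩, rfl⟩ := (V₁.prodEquivOfIsCompl V₂ h).surjective v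
    rw [Submodule.coe_prodEquivOfIsCompl', map_add, map_add, h₁, h₂, prodAct_apply_left,
      prodAct_apply_right]

lemma prodAct_injective {V₁ V₂ : Submodule ℂ V} (h : IsCompl V₁ V₂) :
    Function.Injective (prodAct h) := by
  intro p q hpq
  obtain ⟨h₁, h₂⟩ := (eq_prodAct_iff h (prodAct h p) q).mp hpq
  refine Prod.ext (LinearEquiv.ext fun x => Subtype.ext ?_)
    (LinearEquiv.ext fun x => Subtype.ext ?_)
  · rw [← h₁, prodAct_apply_left]
  · rw [← h₂, prodAct_apply_right]

/-- A reflection with root in a stable subspace `U` and coroot nonzero on `U` restricts to a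
reflection of `U`. -/
lemma exists_reflection_restrict [FiniteDimensional ℂ V] {U : Submodule ℂ V} {t : V ≃ₗ[ℂ] V}
    (htU : ∀ u ∈ U, t u ∈ U) (htU' : ∀ u ∈ U, t.symm u ∈ U)
    {α : V} {f : Module.Dual ℂ V} (hα : α ≠ 0) (ht : ∀ v, t v = v + f v • α)
    (hαU : α ∈ U) (hf : ∃ u ∈ U, f u ≠ 0) :
    ∃ t₁ : U ≃ₗ[ℂ] U, IsReflection t₁ ∧ ∀ x : U, t x = (t₁ x : V) := by
  let t₁ : U ≃ₗ[ℂ] U := LinearEquiv.ofLinearMap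
    ((t : V →ₗ[ℂ] V).restrict htU) ((t.symm : V →ₗ[ℂ] V).restrict htU')
    (by ext; simp) (by ext; simp)
  refine ⟨t₁, isReflection_of_root (α := ⟨α, hαU⟩) (f := f ∘ₗ U.subtype) ?_ ?_ ?_, fun x => rfl⟩
  · exact fun h => hα (congrArg Subtype.val h)
  · obtain ⟨u, hu, hfu⟩ := hf
    exact fun h => hfu (LinearMap.congr_fun h ⟨u, hu⟩)
  · exact fun v => Subtype.ext (ht v)

/-- The subgroup generated by the reflections that an injective homomorphism `φ` maps into a finite
group `W` is a complex reflection group, and `φ` maps it into `W`. -/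
lemma isComplexReflectionGroup_closure {W : Subgroup (V ≃ₗ[ℂ] V)}
    [Finite W] {E : Type*} [AddCommGroup E] [Module ℂ E] [FiniteDimensional ℂ E]
    (φ : (E ≃ₗ[ℂ] E) →* (V ≃ₗ[ℂ] V)) (hφ : Function.Injective φ) :
    IsComplexReflectionGroup (Subgroup.closure {t : E ≃ₗ[ℂ] E | IsReflection t ∧ φ t ∈ W}) ∧
      Subgroup.closure {t : E ≃ₗ[ℂ] E | IsReflection t ∧ φ t ∈ W} ≤ W.comap φ := by
  have hle : Subgroup.closure {t : E ≃ₗ[ℂ] E | IsReflection t ∧ φ t ∈ W} ≤ W.comap φ := by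
    rw [Subgroup.closure_le]
    exact fun t ht => ht.2
  refine ⟨⟨inferInstance, ?_, ?_⟩, hle⟩
  · exact Finite.of_injective
      (fun g : Subgroup.closure {t : E ≃ₗ[ℂ] E | IsReflection t ∧ φ t ∈ W} =>
        (⟨φ g.1, hle g.2⟩ : W)) fun a b hab => Subtype.ext (hφ (congrArg Subtype.val hab))
  · refine le_antisymm ?_ (Subgroup.closure_mono fun t ht => ⟨Subgroup.subset_closure ht, ht.1⟩)
    rw [Subgroup.closure_le]
    exact fun t ht => ht.1

/-- A stable subspace on which the coroot of a reflection is nonzero contains its root. So each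
reflection of W has its coroot zero on one summand and acts there trivially. Hence W is the product
of the groups generated by the two kinds of reflections. -/
lemma IsIrreducibleComplexReflectionGroup.eq_bot_or_eq_bot_of_isCompl
    {W : Subgroup (V ≃ₗ[ℂ] V)} (hW : IsIrreducibleComplexReflectionGroup W)
    {V₁ V₂ : Submodule ℂ V} (h : IsCompl V₁ V₂) (h₁ : ∀ g ∈ W, ∀ v ∈ V₁, g v ∈ V₁)
    (h₂ : ∀ g ∈ W, ∀ v ∈ V₂, g v ∈ V₂) : V₁ = ⊥ ∨ V₂ = ⊥ := by
  have := hW.finiteDimensional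
  have := hW.finite
  let φ₁ : (V₁ ≃ₗ[ℂ] V₁) →* (V ≃ₗ[ℂ] V) := (prodAct h).comp (MonoidHom.inl _ _)
  let φ₂ : (V₂ ≃ₗ[ℂ] V₂) →* (V ≃ₗ[ℂ] V) := (prodAct h).comp (MonoidHom.inr _ _)
  obtain ⟨hW₁, hle₁⟩ := isComplexReflectionGroup_closure (W := W) φ₁
    ((prodAct_injective h).comp (Prod.mk_left_injective 1))
  obtain ⟨hW₂, hle₂⟩ := isComplexReflectionGroup_closure (W := W) φ₂
    ((prodAct_injective h).comp (Prod.mk_right_injective 1))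
  refine hW.irreducible V₁ V₂ _ _ hW₁ hW₂ ⟨h, fun g => ⟨fun hg => ?_, ?_⟩⟩
  swap
  · rintro ⟨g₁, hg₁, g₂, hg₂, hg⟩
    rw [(eq_prodAct_iff h g (g₁, g₂)).mpr hg,
      show ((g₁, g₂) : (V₁ ≃ₗ[ℂ] V₁) × (V₂ ≃ₗ[ℂ] V₂)) = (g₁, 1) * (1, g₂) by simp, map_mul]
    exact mul_mem (hle₁ hg₁) (hle₂ hg₂)
  have key : W ≤ Subgroup.map (prodAct h)
      ((Subgroup.closure {t | IsReflection t ∧ φ₁ t ∈ W}).prod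
        (Subgroup.closure {t | IsReflection t ∧ φ₂ t ∈ W})) := by
    conv_lhs => rw [← hW.closure_eq]
    rw [Subgroup.closure_le]
    rintro t ⟨htW, ht⟩
    obtain ⟨α, f, hα, hf, htα⟩ := ht.exists_root
    have hmem : ∀ {U : Submodule ℂ V}, (∀ g ∈ W, ∀ v ∈ U, g v ∈ U) →
        (∃ u ∈ U, f u ≠ 0) → α ∈ U := by
      rintro U hU ⟨u, hu, hfu⟩
      have h := U.sub_mem (hU t htW u hu) hu
      rw [htα, add_sub_cancel_left] at h
      exact (U.smul_mem_iff hfu).mp h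
    have hnot : ¬ ((∃ u ∈ V₁, f u ≠ 0) ∧ ∃ u ∈ V₂, f u ≠ 0) := fun ⟨ha, hb⟩ =>
      hα (Submodule.disjoint_def.mp h.disjoint α (hmem h₁ ha) (hmem h₂ hb))
    by_cases hf₁ : ∃ u ∈ V₁, f u ≠ 0
    · have hf₂ : ∀ u ∈ V₂, f u = 0 := by
        by_contra! hb
        exact hnot ⟨hf₁, hb⟩
      obtain ⟨t₁, ht₁, hres⟩ := exists_reflection_restrict (h₁ t htW)
        (h₁ t⁻¹ (inv_mem htW)) hα htα (hmem h₁ hf₁) hf₁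
      have e : t = prodAct h (t₁, 1) := (eq_prodAct_iff h t (t₁, 1)).mpr
        ⟨hres, fun x => by simp [htα, hf₂ x x.2]⟩
      refine ⟨(t₁, 1), ⟨Subgroup.subset_closure ⟨ht₁, ?_⟩, one_mem _⟩, e.symm⟩
      change prodAct h (t₁, 1) ∈ W
      rwa [← e]
    · push Not at hf₁
      have hf₂ : ∃ u ∈ V₂, f u ≠ 0 := by
        by_contra! hb
        refine hf (LinearMap.ext fun v => ?_)
        obtain ⟨⟨x, y⟩, rfl⟩ := (V₁.prodEquivOfIsCompl V₂ h).surjective v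
        rw [Submodule.coe_prodEquivOfIsCompl', map_add, hf₁ x x.2, hb y y.2, add_zero]
        rfl
      obtain ⟨t₂, ht₂, hres⟩ := exists_reflection_restrict (h₂ t htW)
        (h₂ t⁻¹ (inv_mem htW)) hα htα (hmem h₂ hf₂) hf₂
      have e : t = prodAct h (1, t₂) := (eq_prodAct_iff h t (1, t₂)).mpr
        ⟨fun x => by simp [htα, hf₁ x x.2], hres⟩
      refine ⟨(1, t₂), ⟨one_mem _, Subgroup.subset_closure ⟨ht₂, ?_⟩⟩, e.symm⟩
      change prodAct h (1, t₂) ∈ W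
      rwa [← e]
  obtain ⟨⟨g₁, g₂⟩, ⟨hg₁, hg₂⟩, rfl⟩ := key hg
  exact ⟨g₁, hg₁, g₂, hg₂, prodAct_apply_left h _, prodAct_apply_right h _⟩

/-- An irreducible complex reflection group acts irreducibly. -/
lemma IsIrreducibleComplexReflectionGroup.eq_bot_or_eq_top
    {W : Subgroup (V ≃ₗ[ℂ] V)} (hW : IsIrreducibleComplexReflectionGroup W) (U : Submodule ℂ V)
    (hU : ∀ g ∈ W, ∀ v ∈ U, g v ∈ U) : U = ⊥ ∨ U = ⊤ := by
  have := hW.finite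
  have : NeZero (Nat.card W : ℂ) := ⟨Nat.cast_ne_zero.mpr Nat.card_pos.ne'⟩
  let ρ : Representation ℂ W V :=
    (LinearEquiv.automorphismGroup.toLinearMapMonoidHom (R := ℂ) (M := V)).comp W.subtype
  let S : Subrepresentation ρ := ⟨U, fun g v hv => hU g.1 g.2 v hv⟩
  -- Maschke's theorem provides a W-stable complement.
  have : Representation.IsSemisimpleRepresentation ρ := inferInstance
  obtain ⟨T, hT⟩ := exists_isCompl S
  have hc : IsCompl U T.toSubmodule := by
    refine ⟨disjoint_iff.mpr ?_, codisjoint_iff.mpr ?_⟩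
    · exact congrArg Subrepresentation.toSubmodule hT.inf_eq_bot
    · exact congrArg Subrepresentation.toSubmodule hT.sup_eq_top
  refine (hW.eq_bot_or_eq_bot_of_isCompl hc hU
    fun g hg v hv => T.apply_mem_toSubmodule ⟨g, hg⟩ hv).imp_right fun h => ?_
  have := hc.sup_eq_top
  rwa [h, sup_bot_eq] at this

/-- A nonzero fixed vector makes the fixed subspace all of V, so W is trivial. Then every line is
stable, so dim V = 1, the excluded case. -/
lemma IsIrreducibleComplexReflectionGroup.eq_zero_of_fixed
    {W : Subgroup (V ≃ₗ[ℂ] V)} (hW : IsIrreducibleComplexReflectionGroup W)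
    (hnontriv : Module.finrank ℂ V = 1 → W ≠ ⊥) {v : V} (hv : ∀ g ∈ W, g v = v) : v = 0 := by
  by_contra hv0
  let F : Submodule ℂ V :=
    { carrier := {v | ∀ g ∈ W, g v = v}
      add_mem' := fun ha hb g hg => by rw [map_add, ha g hg, hb g hg]
      zero_mem' := fun g _ => map_zero g
      smul_mem' := fun c a ha g hg => by rw [map_smul, ha g hg] }
  have hF : F = ⊤ := (hW.eq_bot_or_eq_top F fun g hg v hv k hk => by
    rw [hv g hg, hv k hk]).resolve_left fun h => hv0 ((Submodule.mem_bot ℂ).mp (h ▸ hv : v ∈ _))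
  have hfix : ∀ g ∈ W, ∀ w, g w = w := fun g hg w => (hF ▸ Submodule.mem_top : w ∈ F) g hg
  have hbot : W = ⊥ := (Subgroup.eq_bot_iff_forall W).mpr fun g hg => LinearEquiv.ext (hfix g hg)
  refine hnontriv ?_ hbot
  rcases hW.eq_bot_or_eq_top (Submodule.span ℂ {v}) fun g hg w hw => by rwa [hfix g hg] with h | h
  · exact absurd (Submodule.span_singleton_eq_bot.mp h) hv0
  · rw [← finrank_top, ← h, finrank_span_singleton hv0]

/-- Invariants of an irreducible complex reflection group are annihilated by `𝔤𝔩(V)`. -/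
lemma invariants_le_glInvariants {W : Subgroup (V ≃ₗ[ℂ] V)}
    (hW : IsIrreducibleComplexReflectionGroup W) (hnontriv : Module.finrank ℂ V = 1 → W ≠ ⊥) :
    Subalgebra.toSubmodule (invariants W) ≤ glInvariants V := by
  have := hW.finiteDimensional
  have := hW.finite
  intro x hx
  rw [mem_glInvariants]
  obtain ⟨H, hinv, hstar, hpos⟩ := exists_invariant_hermitian_form W
  let R : Set (V × Module.Dual ℂ V) :=
    {r | r.1 ≠ 0 ∧ r.2 ≠ 0 ∧ ∃ t ∈ W, ∀ v, t v = v + r.2 v • r.1}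
  -- A vector w fixed by t satisfies H(w, t v) = H(w, v), so it is orthogonal to the root.
  have horth : ∀ r ∈ R, ∀ w, r.2 w = 0 → H w r.1 = 0 := by
    rintro ⟨α, f⟩ ⟨-, hf, t, htW, ht⟩ w hw
    obtain ⟨v, hv⟩ : ∃ v, f v ≠ 0 := by
      by_contra! h
      exact hf (LinearMap.ext h)
    have e := hinv t htW w v
    simp only at hw ht
    rw [ht w, hw, zero_smul, add_zero, ht v, map_add, map_smul, add_eq_left] at e
    exact (smul_eq_zero_iff_right hv).mp e
  -- Otherwise the root would be orthogonal to itself; finite groups contain no transvections.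
  have hself : ∀ r ∈ R, r.2 r.1 ≠ 0 := fun r hr h0 => hr.1 (hpos _ (horth r hr r.1 h0))
  have hstable : ∀ U : Submodule ℂ V, (∀ r ∈ R, ∀ u ∈ U, r.2 u • r.1 ∈ U) →
      ∀ g ∈ W, ∀ u ∈ U, g u ∈ U := by
    intro U hU g hg
    rw [← hW.closure_eq] at hg
    induction hg using Subgroup.closure_induction with
    | mem t ht =>
      obtain ⟨α, f, hα, hf, htα⟩ := ht.2.exists_root
      intro u hu
      rw [htα]
      exact U.add_mem hu (hU (α, f) ⟨hα, hf, t, ht.1, htα⟩ u hu)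
    | one => exact fun u hu => hu
    | mul a b _ _ ha hb => exact fun u hu => ha _ (hb u hu)
    | inv a _ ha =>
      intro u hu
      -- An injective map of the finite-dimensional U into itself is onto, so the inverse preserves
      -- U too.
      have hmap : U.map (a : V →ₗ[ℂ] V) = U :=
        Submodule.eq_of_le_of_finrank_eq (Submodule.map_le_iff_le_comap.mpr ha)
          (LinearEquiv.finrank_map_eq a U)
      rw [← hmap] at hu
      obtain ⟨w, hw, rfl⟩ := hu
      change a.symm (a w) ∈ U
      rwa [a.symm_apply_apply]
  refine rankOneAct_eq_zero_of_irreducible R ?_ hself ?_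
    (fun U hU => hW.eq_bot_or_eq_top U (hstable U hU)) ?_
  · rintro ⟨α, f⟩ hr
    have hfα := hself _ hr
    obtain ⟨hα, -, t, htW, ht⟩ := hr
    -- Since t α = (1 + f α)α, the factor 1 + f α is nonzero by injectivity of t.
    refine rankOneAct_eq_zero_of_act_eq ht (fun h => hα ?_) hfα (hx t htW)
    refine t.map_eq_zero_iff.mp ?_
    have e := ht α
    simp only at e
    rw [e]
    calc α + f α • α = (1 + f α) • α := by rw [add_smul, one_smul]
      _ = 0 := by rw [h, zero_smul]
  · rintro ⟨α, f⟩ hr ⟨β, g⟩ hs h0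
    simp only at h0 ⊢
    have h₁ : H β α = 0 := by
      rw [hstar α β, horth _ hs α h0, star_zero]
    have hfα : f α ≠ 0 := hself _ hr
    -- The projection of β to the hyperplane `f = 0` is orthogonal to α, and so is β; hence the
    -- multiple of α removed from β is zero.
    have h₂ : H (β - (f β / f α) • α) α = 0 := by
      refine horth _ hr _ ?_
      simp only [map_sub, map_smul, smul_eq_mul]
      rw [div_mul_cancel₀ _ hfα, sub_self]
    have h₃ : H α (β - (f β / f α) • α) = 0 := by rw [hstar _ α, h₂, star_zero]
    rw [map_sub, map_smul, hstar β α, h₁, star_zero, zero_sub, neg_eq_zero, smul_eq_zero,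
      div_eq_zero_iff] at h₃
    rcases h₃ with (h | h) | h
    · exact h
    · exact absurd h hfα
    · exact absurd (hpos α h) hr.1
  · intro v hv
    refine hW.eq_zero_of_fixed hnontriv fun g hg => ?_
    rw [← hW.closure_eq] at hg
    induction hg using Subgroup.closure_induction with
    | mem t ht =>
      obtain ⟨α, f, hα, hf, htα⟩ := ht.2.exists_root
      rw [htα, hv (α, f) ⟨hα, hf, t, ht.1, htα⟩, zero_smul, add_zero]
    | one => rfl
    | mul a b _ _ ha hb => rw [LinearEquiv.mul_apply, hb, ha]
    | inv a _ ha => exact (LinearEquiv.symm_apply_eq a).mpr ha.symm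

variable {W : Subgroup (V ≃ₗ[ℂ] V)} {n : ℕ} {θ : Module.Basis (Fin n) ℂ V}

lemma casimir_mem_invariants : casimir θ ∈ invariants W := fun g _ => act_casimir θ g

lemma invariants_inf_bidegree_of_ne
    (hgl : Subalgebra.toSubmodule (invariants W) ≤ glInvariants V)
    (θ : Module.Basis (Fin n) ℂ V) {i j : ℕ} (hij : i ≠ j) :
    Subalgebra.toSubmodule (invariants W) ⊓ bidegree V i j = ⊥ := by
  rw [eq_bot_iff]
  rintro x ⟨hx, hxb⟩
  obtain ⟨h₁, h₂⟩ := num_of_mem_bidegree (θ := θ) hxb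
  rw [numDual_eq_numV (hgl hx), h₁, ← sub_eq_zero, ← sub_smul] at h₂
  exact (smul_eq_zero_iff_right (sub_ne_zero.mpr (Nat.cast_injective.ne hij))).mp h₂

lemma invariants_inf_bidegree_self
    (hgl : Subalgebra.toSubmodule (invariants W) ≤ glInvariants V) (i : ℕ) :
    Subalgebra.toSubmodule (invariants W) ⊓ bidegree V i i =
      Submodule.span ℂ {casimir θ ^ i} := by
  refine le_antisymm ?_ ?_
  · rintro x ⟨hx, hxb⟩
    exact mem_span_casimir_pow (hgl hx) (num_of_mem_bidegree hxb).1
  · rw [Submodule.span_singleton_le_iff_mem]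
    exact ⟨pow_mem casimir_mem_invariants i, casimir_pow_mem_bidegree i⟩

end Irreducible

end CasimirGeneration

end

theorem proposition4p1 {V : Type*} [AddCommGroup V] [Module ℂ V]
    (W : Subgroup (V ≃ₗ[ℂ] V)) (hW : CasimirGeneration.IsIrreducibleComplexReflectionGroup W)
    (n : ℕ) (θ : Module.Basis (Fin n) ℂ V)
    (hnontriv : n = 1 → W ≠ ⊥) :
    Algebra.adjoin ℂ {CasimirGeneration.casimir θ} = CasimirGeneration.invariants W ∧
    (∀ i j : ℕ,
      Module.finrank ℂ
        ↥(Subalgebra.toSubmodule (CasimirGeneration.invariants W) ⊓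
          CasimirGeneration.bidegree V i j) =
        if i = j ∧ i ≤ n then 1 else 0) ∧
    (∀ i j : ℕ, i ≠ j →
      Subalgebra.toSubmodule (CasimirGeneration.invariants W) ⊓
        CasimirGeneration.bidegree V i j = ⊥) ∧
    (∀ i : ℕ,
      Subalgebra.toSubmodule (CasimirGeneration.invariants W) ⊓
        CasimirGeneration.bidegree V i i =
        Submodule.span ℂ {CasimirGeneration.casimir θ ^ i}) := by
  have hgl := CasimirGeneration.invariants_le_glInvariants hW (by
    rwa [Module.finrank_eq_card_basis θ, Fintype.card_fin])
  have hoff := fun i j (hij : i ≠ j) => CasimirGeneration.invariants_inf_bidegree_of_ne hgl θ hij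
  have hdiag := CasimirGeneration.invariants_inf_bidegree_self (θ := θ) hgl
  refine ⟨le_antisymm ?_ ?_, fun i j => ?_, hoff, hdiag⟩
  · rw [Algebra.adjoin_le_iff, Set.singleton_subset_iff]
    exact CasimirGeneration.casimir_mem_invariants
  · exact fun x hx => CasimirGeneration.glInvariants_le_adjoin (hgl hx)
  · split_ifs with h
    · obtain ⟨rfl, hi⟩ := h
      rw [hdiag, finrank_span_singleton (CasimirGeneration.casimir_pow_ne_zero hi)]
    · by_cases hij : i = j
      · subst hij
        rw [hdiag, CasimirGeneration.casimir_pow_eq_zero (by simpa using h),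
          Submodule.span_zero_singleton, finrank_bot]
      · rw [hoff i j hij, finrank_bot]
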